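/- Let $0<q<1$. Let $\mathcal H$ be the Hilbert space with orthonormal basis $f^{(n)}_{x,y}$, $n\in\mathbb N=\{0,1,2,\dots\}$, $x,y\in\{0,\dots,n\}$ (in the usual notation $f^{(n)}_{x,y}=e^{(n/2)}_{x-n/2,\,y-n/2}$), and let $D$ be the self-adjoint diagonal operator with $Df^{(n)}_{x,y}=n\,f^{(n)}_{x,y}$ if $x=n$ and $Df^{(n)}_{x,y}=-n\,f^{(n)}_{x,y}$ otherwise. Let $\delta(T)=[|D|,T]$ be the associated unbounded derivation of the algebra of bounded operators on $\mathcal H$. Define bounded operators on $\mathcal H$ by $$\alpha_+f^{(n)}_{x,y}=q^{x+y+1}\frac{(1-q^{2(n-y)+2})^{1/2}(1-q^{2(n-x)+2})^{1/2}}{(1-q^{2n+2})^{1/2}(1-q^{2n+4})^{1/2}}\,f^{(n+1)}_{x,y},\qquad \alpha_-f^{(n)}_{x,y}=\frac{(1-q^{2y})^{1/2}(1-q^{2x})^{1/2}}{(1-q^{2n})^{1/2}(1-q^{2n+2})^{1/2}}\,f^{(n-1)}_{x-1,y-1},$$ $$\beta_+f^{(n)}_{x,y}=-q^{y}\frac{(1-q^{2(n-y)+2})^{1/2}(1-q^{2x+2})^{1/2}}{(1-q^{2n+2})^{1/2}(1-q^{2n+4})^{1/2}}\,f^{(n+1)}_{x+1,y},\qquad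 \beta_-f^{(n)}_{x,y}=q^{x}\frac{(1-q^{2y})^{1/2}(1-q^{2(n-x)})^{1/2}}{(1-q^{2n})^{1/2}(1-q^{2n+2})^{1/2}}\,f^{(n-1)}_{x,y-1},$$ where $\alpha_-f^{(n)}_{x,y}=0$ if $x=0$ or $y=0$, and $\beta_-f^{(n)}_{x,y}=0$ if $y=0$ or $x=n$. Put $\alpha=\alpha_++\alpha_-$ and $\beta=\beta_++\beta_-$ (the standard representation of $SU_q(2)$), let $\mathcal A$ be the unital $*$-algebra generated by $\alpha,\beta$, and let $\mathcal B$ be the algebra generated by all $\delta^k(a)$, $a\in\mathcal A$, $k\in\mathbb N$; it contains $\alpha_\pm$ and $\beta_\pm$. Let $C^\infty(D^2_{q+})$ and $C^\infty(D^2_{q-})$ both be the smooth Toeplitz algebra, that is, the $*$-algebra of all operators $T_f+R$ on $\ell^2(\mathbb N)$ (with basis $\varepsilon_x$), where $T_f$ is the Toeplitz operator with symbol $f\in C^\infty(S^1)$ and $R$ a matrix of rapid decay. In $C^\infty(D^2_{q\pm})$ let $\alpha$ and $\beta$ denote the elements $\alpha\,\varepsilon_x=(1-q^{2x})^{1/2}\varepsilon_{x-1}$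 (with $\alpha\,\varepsilon_0=0$) and $\beta\,\varepsilon_x=\pm q^x\varepsilon_x$, and let $u=e^{i\theta}$ be the generator of $C^\infty(S^1)$. Then there is exactly one unital $*$-homomorphism $$\rho:\mathcal B\to C^\infty(D^2_{q+})\otimes C^\infty(D^2_{q-})\otimes C^\infty(S^1)$$ (algebraic tensor product over $\mathbb C$) such that $$\rho(\alpha_+)=-q\,\beta^*\otimes\beta\otimes u,\quad \rho(\alpha_-)=\alpha\otimes\alpha\otimes u^*,\quad \rho(\beta_+)=\alpha^*\otimes\beta\otimes u,\quad \rho(\beta_-)=\beta\otimes\alpha\otimes u^*.$$ -/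

import Mathlib

open scoped TensorProduct ContDiff

noncomputable section

namespace SUq2

/-! ### Hilbert spaces with a distinguished basis and weighted partial shifts -/

/-- The Hilbert space `ℓ²(ι)`. -/
abbrev Ell2 (ι : Type) : Type := lp (fun _ : ι => ℂ) 2

/-- The basis vector of `ℓ²(ι)` with index `i`. -/
def ket {ι : Type} (i : ι) : Ell2 ι :=
  letI := Classical.decEq ι
  lp.single 2 i 1

/-- An injective map, seen as a partial bijection. -/
def ofInjective {ι κ : Type} (g : ι → κ) (hg : Function.Injective g) : ι ≃. κ where
  toFun i := some (g i)
  invFun := Function.partialInv g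
  inv a b := by
    rw [hg.isPartialInv a b, Option.some.injEq]

theorem weightedShift_aux {ι κ : Type} (e : ι ≃. κ) (c : ι → ℂ) (hc : ∀ i, ‖c i‖ ≤ 1)
    (ξ : Ell2 ι) (s : Finset κ) :
    ∑ j ∈ s, ‖(e.symm j).elim 0 (fun i => c i * ξ i)‖ ^ (2 : ENNReal).toReal
      ≤ ‖ξ‖ ^ (2 : ENNReal).toReal := by
  classical
  have h2 : (0 : ℝ) < (2 : ENNReal).toReal := by norm_num
  let t : Finset ι := s.biUnion fun j => (e.symm j).toFinset
  refine le_trans ?_ (lp.sum_rpow_le_norm_rpow h2 ξ t)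
  have hdis : Set.PairwiseDisjoint (s : Set κ) fun j => (e.symm j).toFinset := by
    intro j _ j' _ hjj'
    refine Finset.disjoint_left.2 fun i hi hi' => hjj' ?_
    rw [Option.mem_toFinset] at hi hi'
    exact e.symm.inj hi hi'
  rw [Finset.sum_biUnion hdis]
  refine Finset.sum_le_sum fun j _ => ?_
  cases h : e.symm j with
  | none => simp
  | some i =>
    simp only [Option.elim, Option.toFinset_some, Finset.sum_singleton]
    refine Real.rpow_le_rpow (norm_nonneg _) ?_ h2.le
    rw [norm_mul]
    exact mul_le_of_le_one_left (norm_nonneg _) (hc i)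

/-- The bounded operator `ℓ²(ι) → ℓ²(κ)` which sends the basis vector of index `i` to `c i` times
the basis vector of index `e i`, and to `0` where `e` is not defined; see `weightedShift_ket`. -/
def weightedShift {ι κ : Type} (e : ι ≃. κ) (c : ι → ℂ) (hc : ∀ i, ‖c i‖ ≤ 1) :
    Ell2 ι →L[ℂ] Ell2 κ :=
  LinearMap.mkContinuous
    { toFun := fun ξ => ⟨fun j => (e.symm j).elim 0 (fun i => c i * ξ i),
        memℓp_gen' (weightedShift_aux e c hc ξ)⟩
      map_add' := fun ξ η => by
        ext j
        change (e.symm j).elim 0 (fun i => c i * (ξ i + η i)) =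
          (e.symm j).elim 0 (fun i => c i * ξ i) + (e.symm j).elim 0 (fun i => c i * η i)
        cases e.symm j with
        | none => simp
        | some i => simp [mul_add]
      map_smul' := fun z ξ => by
        ext j
        change (e.symm j).elim 0 (fun i => c i * (z * ξ i)) =
          z * (e.symm j).elim 0 (fun i => c i * ξ i)
        cases e.symm j with
        | none => simp
        | some i => simp [mul_left_comm] }
    1 fun ξ => by
      rw [one_mul]
      exact lp.norm_le_of_forall_sum_le (by norm_num) (norm_nonneg _)
        (weightedShift_aux e c hc ξ)

theorem weightedShift_apply {ι κ : Type} (e : ι ≃. κ) (c : ι → ℂ) (hc : ∀ i, ‖c i‖ ≤ 1)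
    (ξ : Ell2 ι) (j : κ) :
    weightedShift e c hc ξ j = (e.symm j).elim 0 (fun i => c i * ξ i) := rfl

theorem ket_apply {ι : Type} [DecidableEq ι] (i j : ι) :
    (ket i : Ell2 ι) j = if j = i then 1 else 0 := by
  by_cases h : j = i
  · subst h
    rw [if_pos rfl]
    exact @lp.single_apply_self _ _ _ (Classical.decEq ι) 2 j 1
  · rw [if_neg h]
    exact @lp.single_apply_ne _ _ _ (Classical.decEq ι) 2 i 1 j h

theorem weightedShift_ket {ι κ : Type} (e : ι ≃. κ) (c : ι → ℂ) (hc : ∀ i, ‖c i‖ ≤ 1) (i : ι) :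
    weightedShift e c hc (ket i) = (e i).elim 0 (fun j => c i • ket j) := by
  classical
  ext j
  rw [weightedShift_apply]
  cases h : e.symm j with
  | none =>
    cases h' : e i with
    | none => simp
    | some j' =>
      have hne : j ≠ j' := by
        rintro rfl
        rw [(e.eq_some_iff).2 h'] at h
        simp at h
      simp [ket_apply, hne]
  | some i' =>
    have h1 : e i' = some j := (e.eq_some_iff).1 h
    by_cases hi : i' = i
    · subst hi
      simp [h1, ket_apply]
    · cases h' : e i with
      | none => simp [ket_apply, hi]
      | some j' =>
        have hne : j ≠ j' := by
          rintro rfl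
          exact hi (e.inj h1 h')
        simp [ket_apply, hne, hi]

/-! ### The Hilbert space of the spectral triple and the derivation `δ` -/

/-- Index set of the orthonormal basis `e^{(n/2)}_{i,j}`, `n ∈ ℕ`, with the labels
`x = n/2 + i` and `y = n/2 + j`, which run through `{0, …, n}`. -/
@[ext]
structure Idx where
  n : ℕ
  x : ℕ
  y : ℕ
  hx : x ≤ n
  hy : y ≤ n

/-- The Hilbert space with orthonormal basis `e^{(n/2)}_{i,j}`. -/
abbrev Hil : Type := Ell2 Idx

/-- The eigenvalue `(2 δ₀(n/2 - i) - 1) n` of the diagonal operator `D` at `e^{(n/2)}_{i,j}`;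
`i = n/2` means `x = n`. -/
def diracEigenvalue (p : Idx) : ℝ := (2 * (if p.x = p.n then 1 else 0) - 1) * p.n

/-- `IsAbsD ξ η` means that `ξ` lies in the domain of the self-adjoint operator `|D|`, and
`η = |D| ξ`. -/
def IsAbsD (ξ η : Hil) : Prop := ∀ p : Idx, η p = (|diracEigenvalue p| : ℝ) * ξ p

/-- `IsDelta T S` means that the bounded operator `T` lies in the domain of the derivation
`δ = [|D|, ·]` and that `S = δ(T)`: `T` maps the domain of `|D|` to itself, and there
`|D| T ξ = T |D| ξ + S ξ`. -/
def IsDelta (T S : Hil →L[ℂ] Hil) : Prop :=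
  ∀ ξ η : Hil, IsAbsD ξ η → IsAbsD (T ξ) (T η + S ξ)

/-- `IsDeltaPow k T S` means that `T` lies in the domain of `δ ^ k` and `S = δ ^ k (T)`. -/
def IsDeltaPow : ℕ → (Hil →L[ℂ] Hil) → (Hil →L[ℂ] Hil) → Prop
  | 0, T, S => S = T
  | k + 1, T, S => ∃ R, IsDeltaPow k T R ∧ IsDelta R S

theorem abs_diracEigenvalue (p : Idx) : |diracEigenvalue p| = p.n := by
  unfold diracEigenvalue
  split_ifs <;> norm_num

/-! ### The coefficients of the representation -/

/-- `a_+(n/2, i, j)` in terms of `n`, `x = n/2 + i`, `y = n/2 + j`. -/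
def aPlus (q : ℝ) (n x y : ℕ) : ℝ :=
  q ^ (x + y + 1) * (√(1 - q ^ (2 * (n - y) + 2)) * √(1 - q ^ (2 * (n - x) + 2)) /
    (√(1 - q ^ (2 * n + 2)) * √(1 - q ^ (2 * n + 4))))

/-- `a_-(n/2, i, j)`; it vanishes for `x = 0` and for `y = 0`. -/
def aMinus (q : ℝ) (n x y : ℕ) : ℝ :=
  √(1 - q ^ (2 * y)) * √(1 - q ^ (2 * x)) / (√(1 - q ^ (2 * n)) * √(1 - q ^ (2 * n + 2)))

/-- `b_+(n/2, i, j)`. -/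
def bPlus (q : ℝ) (n x y : ℕ) : ℝ :=
  -q ^ y * (√(1 - q ^ (2 * (n - y) + 2)) * √(1 - q ^ (2 * x + 2)) /
    (√(1 - q ^ (2 * n + 2)) * √(1 - q ^ (2 * n + 4))))

/-- `b_-(n/2, i, j)`; it vanishes for `y = 0` and for `x = n`. -/
def bMinus (q : ℝ) (n x y : ℕ) : ℝ :=
  q ^ x * (√(1 - q ^ (2 * y)) * √(1 - q ^ (2 * (n - x))) /
    (√(1 - q ^ (2 * n)) * √(1 - q ^ (2 * n + 2))))

theorem sqrt_quot_le_one (q : Set.Ioo (0 : ℝ) 1) {a b c d : ℕ} (h1 : a ≤ c) (h2 : b ≤ d) :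
    √(1 - (q : ℝ) ^ a) * √(1 - (q : ℝ) ^ b) / (√(1 - (q : ℝ) ^ c) * √(1 - (q : ℝ) ^ d)) ≤ 1 := by
  have key : ∀ {m l : ℕ}, m ≤ l → √(1 - (q : ℝ) ^ m) ≤ √(1 - (q : ℝ) ^ l) := fun h =>
    Real.sqrt_le_sqrt (sub_le_sub_left (pow_le_pow_of_le_one q.2.1.le q.2.2.le h) 1)
  exact div_le_one_of_le₀ (mul_le_mul (key h1) (key h2) (Real.sqrt_nonneg _) (Real.sqrt_nonneg _))
    (by positivity)

theorem norm_coeff_le_one {s t : ℝ} (hs : |s| ≤ 1) (ht : 0 ≤ t) (ht' : t ≤ 1) :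
    ‖((s * t : ℝ) : ℂ)‖ ≤ 1 := by
  rw [Complex.norm_real, Real.norm_eq_abs, abs_mul, abs_of_nonneg ht]
  exact mul_le_one₀ hs ht ht'

theorem abs_pow_le_one (q : Set.Ioo (0 : ℝ) 1) (k : ℕ) : |(q : ℝ) ^ k| ≤ 1 := by
  rw [abs_of_nonneg (pow_nonneg q.2.1.le k)]
  exact pow_le_one₀ q.2.1.le q.2.2.le

theorem norm_aPlus_le (q : Set.Ioo (0 : ℝ) 1) (p : Idx) : ‖(aPlus q p.n p.x p.y : ℂ)‖ ≤ 1 :=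
  norm_coeff_le_one (abs_pow_le_one q _) (by positivity)
    (sqrt_quot_le_one q (by omega) (by omega))

theorem norm_aMinus_le (q : Set.Ioo (0 : ℝ) 1) (p : Idx) : ‖(aMinus q p.n p.x p.y : ℂ)‖ ≤ 1 := by
  have h := norm_coeff_le_one (s := 1) (by simp) (by positivity)
    (sqrt_quot_le_one q (a := 2 * p.y) (b := 2 * p.x) (c := 2 * p.n) (d := 2 * p.n + 2)
      (by have := p.hy; omega) (by have := p.hx; omega))
  rwa [one_mul] at h

theorem norm_bPlus_le (q : Set.Ioo (0 : ℝ) 1) (p : Idx) : ‖(bPlus q p.n p.x p.y : ℂ)‖ ≤ 1 :=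
  norm_coeff_le_one (by rw [abs_neg]; exact abs_pow_le_one q _) (by positivity)
    (sqrt_quot_le_one q (by omega) (by have := p.hx; omega))

theorem norm_bMinus_le (q : Set.Ioo (0 : ℝ) 1) (p : Idx) : ‖(bMinus q p.n p.x p.y : ℂ)‖ ≤ 1 :=
  norm_coeff_le_one (abs_pow_le_one q _) (by positivity)
    (sqrt_quot_le_one q (by have := p.hy; omega) (by omega))

/-! ### The operators `α_±`, `β_±`, `α`, `β` -/

/-- `(n, x, y) ↦ (n + 1, x, y)`. -/
def raise : Idx → Idx := fun p => ⟨p.n + 1, p.x, p.y, p.hx.trans (Nat.le_succ _),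
  p.hy.trans (Nat.le_succ _)⟩

/-- `(n, x, y) ↦ (n + 1, x + 1, y)`. -/
def raiseX : Idx → Idx := fun p => ⟨p.n + 1, p.x + 1, p.y, Nat.succ_le_succ p.hx,
  p.hy.trans (Nat.le_succ _)⟩

/-- `(n, x, y) ↦ (n + 1, x, y + 1)`. -/
def raiseY : Idx → Idx := fun p => ⟨p.n + 1, p.x, p.y + 1, p.hx.trans (Nat.le_succ _),
  Nat.succ_le_succ p.hy⟩

/-- `(n, x, y) ↦ (n + 1, x + 1, y + 1)`. -/
def raiseXY : Idx → Idx := fun p => ⟨p.n + 1, p.x + 1, p.y + 1, Nat.succ_le_succ p.hx,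
  Nat.succ_le_succ p.hy⟩

theorem raise_injective : Function.Injective raise := fun p p' h => by
  simp only [raise, Idx.mk.injEq] at h; ext <;> omega

theorem raiseX_injective : Function.Injective raiseX := fun p p' h => by
  simp only [raiseX, Idx.mk.injEq] at h; ext <;> omega

theorem raiseY_injective : Function.Injective raiseY := fun p p' h => by
  simp only [raiseY, Idx.mk.injEq] at h; ext <;> omega

theorem raiseXY_injective : Function.Injective raiseXY := fun p p' h => by
  simp only [raiseXY, Idx.mk.injEq] at h; ext <;> omega

/-- `α_+ e^{(n/2)}_{i,j} = a_+(n/2,i,j) e^{((n+1)/2)}_{i-1/2,j-1/2}`. -/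
def alphaPlus (q : Set.Ioo (0 : ℝ) 1) : Hil →L[ℂ] Hil :=
  weightedShift (ofInjective raise raise_injective) (fun p => (aPlus q p.n p.x p.y : ℂ))
    (norm_aPlus_le q)

/-- `α_- e^{(n/2)}_{i,j} = a_-(n/2,i,j) e^{((n-1)/2)}_{i-1/2,j-1/2}`, which is `0` if `x = 0` or
`y = 0`. -/
def alphaMinus (q : Set.Ioo (0 : ℝ) 1) : Hil →L[ℂ] Hil :=
  weightedShift (ofInjective raiseXY raiseXY_injective).symm
    (fun p => (aMinus q p.n p.x p.y : ℂ)) (norm_aMinus_le q)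

/-- `β_+ e^{(n/2)}_{i,j} = b_+(n/2,i,j) e^{((n+1)/2)}_{i+1/2,j-1/2}`. -/
def betaPlus (q : Set.Ioo (0 : ℝ) 1) : Hil →L[ℂ] Hil :=
  weightedShift (ofInjective raiseX raiseX_injective) (fun p => (bPlus q p.n p.x p.y : ℂ))
    (norm_bPlus_le q)

/-- `β_- e^{(n/2)}_{i,j} = b_-(n/2,i,j) e^{((n-1)/2)}_{i+1/2,j-1/2}`, which is `0` if `y = 0` or
`x = n`. -/
def betaMinus (q : Set.Ioo (0 : ℝ) 1) : Hil →L[ℂ] Hil :=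
  weightedShift (ofInjective raiseY raiseY_injective).symm
    (fun p => (bMinus q p.n p.x p.y : ℂ)) (norm_bMinus_le q)

/-- The operator `α` of the standard representation. -/
def alpha (q : Set.Ioo (0 : ℝ) 1) : Hil →L[ℂ] Hil := alphaPlus q + alphaMinus q

/-- The operator `β` of the standard representation. -/
def beta (q : Set.Ioo (0 : ℝ) 1) : Hil →L[ℂ] Hil := betaPlus q + betaMinus q

/-- The algebra `𝒜` of `SU_q(2)`, acting on the Hilbert space: the unital `*`-algebra generated by
`α` and `β`. -/
def coordAlgebra (q : Set.Ioo (0 : ℝ) 1) : StarSubalgebra ℂ (Hil →L[ℂ] Hil) :=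
  StarAlgebra.adjoin ℂ {alpha q, beta q}

/-- The pseudo-differential algebra `ℬ`, generated by the operators `δ ^ k (a)`, `a ∈ 𝒜`, `k ∈ ℕ`.
(The set of these operators is stable under `T ↦ T*`, since `δ(T)* = -δ(T*)`.) -/
def pdoAlgebra (q : Set.Ioo (0 : ℝ) 1) : StarSubalgebra ℂ (Hil →L[ℂ] Hil) :=
  StarAlgebra.adjoin ℂ {S | ∃ a ∈ coordAlgebra q, ∃ k : ℕ, IsDeltaPow k a S}

/-! ### `α_±` and `β_±` belong to `ℬ` -/

theorem isDelta_weightedShift (e : Idx ≃. Idx) (c : Idx → ℂ) (hc : ∀ i, ‖c i‖ ≤ 1) (m : ℂ)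
    (hm : ∀ p p', e.symm p' = some p → (p'.n : ℂ) = p.n + m) :
    IsDelta (weightedShift e c hc) (m • weightedShift e c hc) := by
  intro ξ η h p'
  change weightedShift e c hc η p' + m * weightedShift e c hc ξ p' = _
  rw [weightedShift_apply, weightedShift_apply, abs_diracEigenvalue]
  cases hp : e.symm p' with
  | none => simp
  | some p =>
    have h1 := h p
    rw [abs_diracEigenvalue] at h1
    have h2 := hm p p' hp
    simp only [Option.elim, h1, Complex.ofReal_natCast, h2]
    ring

theorem IsDelta.add {T S T' S' : Hil →L[ℂ] Hil} (h : IsDelta T S) (h' : IsDelta T' S') :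
    IsDelta (T + T') (S + S') := by
  intro ξ η hξ p
  have h1 := h ξ η hξ p
  have h2 := h' ξ η hξ p
  simp only [add_apply, lp.coeFn_add, Pi.add_apply] at h1 h2 ⊢
  rw [mul_add, ← h1, ← h2]
  ring

theorem ofInjective_symm_eq_some {g : Idx → Idx} (hg : Function.Injective g) {p p' : Idx} :
    (ofInjective g hg).symm p' = some p ↔ g p = p' := by
  rw [PEquiv.eq_some_iff]
  exact Option.some_inj

theorem ofInjective_symm_symm_eq_some {g : Idx → Idx} (hg : Function.Injective g) {p p' : Idx} :
    (ofInjective g hg).symm.symm p' = some p ↔ g p' = p := by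
  rw [PEquiv.symm_symm]
  exact Option.some_inj

theorem isDelta_alpha (q : Set.Ioo (0 : ℝ) 1) :
    IsDelta (alpha q) ((1 : ℂ) • alphaPlus q + (-1 : ℂ) • alphaMinus q) := by
  refine (isDelta_weightedShift _ _ _ _ ?_).add (isDelta_weightedShift _ _ _ _ ?_)
  · intro p p' h
    rw [ofInjective_symm_eq_some] at h
    subst h
    simp [raise]
  · intro p p' h
    rw [ofInjective_symm_symm_eq_some] at h
    subst h
    simp [raiseXY]

theorem isDelta_beta (q : Set.Ioo (0 : ℝ) 1) :
    IsDelta (beta q) ((1 : ℂ) • betaPlus q + (-1 : ℂ) • betaMinus q) := by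
  refine (isDelta_weightedShift _ _ _ _ ?_).add (isDelta_weightedShift _ _ _ _ ?_)
  · intro p p' h
    rw [ofInjective_symm_eq_some] at h
    subst h
    simp [raiseX]
  · intro p p' h
    rw [ofInjective_symm_symm_eq_some] at h
    subst h
    simp [raiseY]

theorem mem_pdoAlgebra_of_isDelta (q : Set.Ioo (0 : ℝ) 1) {T S : Hil →L[ℂ] Hil}
    (hT : T ∈ coordAlgebra q) (h : IsDelta T S) (s t : ℂ) : s • T + t • S ∈ pdoAlgebra q :=
  add_mem
    (SMulMemClass.smul_mem s (StarAlgebra.subset_adjoin ℂ _ ⟨T, hT, 0, rfl⟩))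
    (SMulMemClass.smul_mem t (StarAlgebra.subset_adjoin ℂ _ ⟨T, hT, 1, T, rfl, h⟩))

theorem alpha_mem (q : Set.Ioo (0 : ℝ) 1) : alpha q ∈ coordAlgebra q :=
  StarAlgebra.subset_adjoin ℂ _ (Or.inl rfl)

theorem beta_mem (q : Set.Ioo (0 : ℝ) 1) : beta q ∈ coordAlgebra q :=
  StarAlgebra.subset_adjoin ℂ _ (Or.inr rfl)

theorem alphaPlus_mem (q : Set.Ioo (0 : ℝ) 1) : alphaPlus q ∈ pdoAlgebra q := by
  have h := mem_pdoAlgebra_of_isDelta q (alpha_mem q) (isDelta_alpha q) (1 / 2) (1 / 2)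
  convert h using 1
  rw [alpha]
  module

theorem alphaMinus_mem (q : Set.Ioo (0 : ℝ) 1) : alphaMinus q ∈ pdoAlgebra q := by
  have h := mem_pdoAlgebra_of_isDelta q (alpha_mem q) (isDelta_alpha q) (1 / 2) (-(1 / 2))
  convert h using 1
  rw [alpha]
  module

theorem betaPlus_mem (q : Set.Ioo (0 : ℝ) 1) : betaPlus q ∈ pdoAlgebra q := by
  have h := mem_pdoAlgebra_of_isDelta q (beta_mem q) (isDelta_beta q) (1 / 2) (1 / 2)
  convert h using 1
  rw [beta]
  module

theorem betaMinus_mem (q : Set.Ioo (0 : ℝ) 1) : betaMinus q ∈ pdoAlgebra q := by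
  have h := mem_pdoAlgebra_of_isDelta q (beta_mem q) (isDelta_beta q) (1 / 2) (-(1 / 2))
  convert h using 1
  rw [beta]
  module

/-! ### The algebra `C^∞(S¹)` -/

/-- The algebra `C^∞(S¹)` of smooth complex functions on the unit circle. -/
def SmoothCircle : StarSubalgebra ℂ C(Circle, ℂ) where
  carrier := {f | ContDiff ℝ ∞ fun t : ℝ => f (Circle.exp t)}
  mul_mem' {f g} hf hg := by
    have hf' : ContDiff ℝ ∞ fun t : ℝ => f (Circle.exp t) := hf
    have hg' : ContDiff ℝ ∞ fun t : ℝ => g (Circle.exp t) := hg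
    exact hf'.mul hg'
  add_mem' {f g} hf hg := by
    have hf' : ContDiff ℝ ∞ fun t : ℝ => f (Circle.exp t) := hf
    have hg' : ContDiff ℝ ∞ fun t : ℝ => g (Circle.exp t) := hg
    exact hf'.add hg'
  algebraMap_mem' c := by
    have h : ContDiff ℝ ∞ fun _ : ℝ => c := contDiff_const
    exact h
  star_mem' {f} hf := by
    have hf' : ContDiff ℝ ∞ fun t : ℝ => f (Circle.exp t) := hf
    exact Complex.conjCLE.contDiff.comp hf'

/-- The canonical generator `u = e^{iθ}` of `C^∞(S¹)`. -/
def circleU : SmoothCircle :=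
  ⟨⟨fun z => (z : ℂ), continuous_subtype_val⟩, by
    change ContDiff ℝ ∞ fun t : ℝ => ((Circle.exp t : Circle) : ℂ)
    simp only [Circle.coe_exp]
    exact (Complex.ofRealCLM.contDiff.mul contDiff_const).cexp⟩

/-! ### The algebras `C^∞(D²_{q±})` -/

/-- The Fourier coefficient of index `m` of a function on the circle. -/
def fourierCoef (f : C(Circle, ℂ)) (m : ℤ) : ℂ :=
  (1 / (2 * Real.pi) : ℝ) *
    ∫ t in (0 : ℝ)..(2 * Real.pi), f (Circle.exp t) * Complex.exp (-(m * t * Complex.I))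

/-- Infinite matrices of rapid decay. -/
def RapidDecay (R : ℕ → ℕ → ℂ) : Prop :=
  ∀ k : ℕ, ∃ C : ℝ, ∀ x y : ℕ, (1 + x + y : ℝ) ^ k * ‖R x y‖ ≤ C

/-- The smooth Toeplitz algebra on `ℓ²(ℕ)`, which is the algebra `C^∞(D²_{q+})`, and also
`C^∞(D²_{q-})`, in its defining representation `π_±`; the two differ only in the generator `β`.
It consists of the operators `T_f + R`, where `R` is a matrix of rapid decay and `T_f` the Toeplitz
operator with smooth symbol `f` (with `T_u ε_x = ε_{x-1}`, so that `f` is the image of `T_f + R`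
under the symbol homomorphism to `C^∞(S¹)`, whose kernel is formed by the matrices of rapid decay).
These operators are stable under sums, products and adjoints, so `StarAlgebra.adjoin` adds
nothing to them. -/
def SmoothDisk : StarSubalgebra ℂ (Ell2 ℕ →L[ℂ] Ell2 ℕ) :=
  StarAlgebra.adjoin ℂ {T | ∃ f ∈ SmoothCircle, ∃ R : ℕ → ℕ → ℂ, RapidDecay R ∧
    ∀ x y : ℕ, T (ket y) x = fourierCoef f ((y : ℤ) - (x : ℤ)) + R x y}

theorem norm_sqrt_le (q : Set.Ioo (0 : ℝ) 1) (k : ℕ) : ‖(√(1 - (q : ℝ) ^ k) : ℂ)‖ ≤ 1 := by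
  rw [Complex.norm_real, Real.norm_eq_abs, abs_of_nonneg (Real.sqrt_nonneg _)]
  exact Real.sqrt_le_one.2 (sub_le_self _ (pow_nonneg q.2.1.le _))

/-- The operator `π_±(α)`: `ε_x ↦ (1 - q^{2x})^{1/2} ε_{x-1}`, `ε_0 ↦ 0`. -/
def diskAlphaOp (q : Set.Ioo (0 : ℝ) 1) : Ell2 ℕ →L[ℂ] Ell2 ℕ :=
  weightedShift (ofInjective Nat.succ Nat.succ_injective).symm
    (fun x => (√(1 - (q : ℝ) ^ (2 * x)) : ℂ)) (fun _ => norm_sqrt_le q _)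

/-- The operator `π_+(β)`: `ε_x ↦ q^x ε_x`. -/
def diskBetaOp (q : Set.Ioo (0 : ℝ) 1) : Ell2 ℕ →L[ℂ] Ell2 ℕ :=
  weightedShift (PEquiv.refl ℕ) (fun x => ((q : ℝ) ^ x : ℝ)) (fun x => by
    rw [Complex.norm_real]; exact abs_pow_le_one q x)

/-! ### The generators of `C^∞(D²_{q±})` -/

theorem fourierCoef_circleU (m : ℤ) :
    fourierCoef (circleU : C(Circle, ℂ)) m = if m = 1 then 1 else 0 := by
  have hpi : (Real.pi : ℂ) ≠ 0 := Complex.ofReal_ne_zero.2 Real.pi_ne_zero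
  have h : ∀ t : ℝ, (circleU : C(Circle, ℂ)) (Circle.exp t) * Complex.exp (-(m * t * Complex.I))
      = Complex.exp ((1 - m) * Complex.I * t) := by
    intro t
    change ((Circle.exp t : Circle) : ℂ) * _ = _
    rw [Circle.coe_exp, ← Complex.exp_add]
    congr 1
    ring
  rw [fourierCoef]
  simp only [h]
  split_ifs with hm
  · subst hm
    simp only [Int.cast_one, sub_self, zero_mul, Complex.exp_zero, intervalIntegral.integral_const,
      sub_zero]
    rw [← Complex.coe_smul]
    push_cast
    simp only [smul_eq_mul, mul_one]
    field_simp
  · have hm' : ((1 : ℂ) - m) * Complex.I ≠ 0 := by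
      refine mul_ne_zero (sub_ne_zero.2 fun h' => hm ?_) Complex.I_ne_zero
      exact_mod_cast h'.symm
    rw [integral_exp_mul_complex hm']
    have h1 : Complex.exp ((1 - m) * Complex.I * ((2 * Real.pi : ℝ) : ℂ)) = 1 := by
      rw [Complex.exp_eq_one_iff]
      exact ⟨1 - m, by push_cast; ring⟩
    rw [h1]
    simp

theorem exists_bound_pow_mul (q : Set.Ioo (0 : ℝ) 1) (k : ℕ) :
    ∃ C : ℝ, ∀ x : ℕ, (1 + 2 * x : ℝ) ^ k * (q : ℝ) ^ x ≤ C := by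
  have hq0 : (0 : ℝ) < q := q.2.1
  have hs : Summable fun n : ℕ => (n : ℝ) ^ k * (q : ℝ) ^ n :=
    summable_pow_mul_geometric_of_norm_lt_one k (by
      rw [Real.norm_eq_abs, abs_of_pos hq0]; exact q.2.2)
  refine ⟨2 ^ k * (q : ℝ)⁻¹ * ∑' n : ℕ, (n : ℝ) ^ k * (q : ℝ) ^ n, fun x => ?_⟩
  have h1 := hs.le_tsum (x + 1) (fun j _ => by positivity)
  have h2 : (1 + 2 * x : ℝ) ^ k ≤ 2 ^ k * ((x + 1 : ℕ) : ℝ) ^ k := by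
    rw [← mul_pow]
    refine pow_le_pow_left₀ (by positivity) ?_ k
    push_cast
    linarith
  calc (1 + 2 * x : ℝ) ^ k * (q : ℝ) ^ x
      ≤ 2 ^ k * ((x + 1 : ℕ) : ℝ) ^ k * (q : ℝ) ^ x := by gcongr
    _ = 2 ^ k * (q : ℝ)⁻¹ * (((x + 1 : ℕ) : ℝ) ^ k * (q : ℝ) ^ (x + 1)) := by
        rw [pow_succ]
        field_simp
    _ ≤ _ := by gcongr

theorem rapidDecay_of_le (q : Set.Ioo (0 : ℝ) 1) {R : ℕ → ℕ → ℂ}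
    (h0 : ∀ x y, y < x → R x y = 0) (h : ∀ x y, ‖R x y‖ ≤ (q : ℝ) ^ y) : RapidDecay R := by
  intro k
  obtain ⟨C, hC⟩ := exists_bound_pow_mul q k
  refine ⟨C, fun x y => ?_⟩
  have hC0 := hC y
  by_cases hxy : y < x
  · rw [h0 x y hxy, norm_zero, mul_zero]
    have hq0 : (0 : ℝ) < q := q.2.1
    exact le_trans (by positivity) hC0
  · refine le_trans (mul_le_mul (pow_le_pow_left₀ (by positivity) ?_ k) (h x y) (norm_nonneg _)
      (by positivity)) hC0
    have : (x : ℝ) ≤ y := by exact_mod_cast not_lt.1 hxy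
    linarith

theorem diskBetaOp_mem (q : Set.Ioo (0 : ℝ) 1) : diskBetaOp q ∈ SmoothDisk := by
  refine StarAlgebra.subset_adjoin ℂ _ ⟨0, zero_mem _,
    fun x y => if x = y then (((q : ℝ) ^ y : ℝ) : ℂ) else 0, rapidDecay_of_le q ?_ ?_, ?_⟩
  · intro x y hxy
    simp [hxy.ne']
  · intro x y
    have hq0 : (0 : ℝ) < q := q.2.1
    split_ifs
    · rw [Complex.norm_real, Real.norm_eq_abs, abs_of_pos (by positivity)]
    · rw [norm_zero]; positivity
  · intro x y
    rw [diskBetaOp, weightedShift_ket]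
    by_cases h : x = y <;> simp [fourierCoef, ket_apply, h]

theorem diskAlphaOp_mem (q : Set.Ioo (0 : ℝ) 1) : diskAlphaOp q ∈ SmoothDisk := by
  have hq0 : (0 : ℝ) < q := q.2.1
  refine StarAlgebra.subset_adjoin ℂ _ ⟨circleU, circleU.2,
    fun x y => if y = x + 1 then ((√(1 - (q : ℝ) ^ (2 * y)) - 1 : ℝ) : ℂ) else 0,
    rapidDecay_of_le q ?_ ?_, ?_⟩
  · intro x y hxy
    rw [if_neg (by omega)]
  · intro x y
    split_ifs
    · have hs : (q : ℝ) ^ (2 * y) ≤ 1 := pow_le_one₀ hq0.le q.2.2.le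
      have hs0 : 0 ≤ (q : ℝ) ^ (2 * y) := by positivity
      have h1 : √(1 - (q : ℝ) ^ (2 * y)) ≤ 1 := Real.sqrt_le_one.2 (by linarith)
      have h2 : 1 - (q : ℝ) ^ (2 * y) ≤ √(1 - (q : ℝ) ^ (2 * y)) :=
        Real.le_sqrt_of_sq_le (by nlinarith)
      have h3 : (q : ℝ) ^ (2 * y) ≤ (q : ℝ) ^ y :=
        pow_le_pow_of_le_one hq0.le q.2.2.le (by omega)
      rw [Complex.norm_real, Real.norm_eq_abs, abs_le]
      constructor <;> linarith
    · rw [norm_zero]; positivity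
  · intro x y
    rw [fourierCoef_circleU, diskAlphaOp, weightedShift_apply, PEquiv.symm_symm]
    change (√(1 - (q : ℝ) ^ (2 * (x + 1))) : ℂ) * (ket y : Ell2 ℕ) (x + 1) = _
    rw [ket_apply]
    beta_reduce
    by_cases h : y = x + 1
    · subst h
      simp
    · rw [if_neg (fun h' => h h'.symm), if_neg (by omega), if_neg h]
      simp

/-- The class `r_±(α)` in `C^∞(D²_{q±})`. -/
def diskAlpha (q : Set.Ioo (0 : ℝ) 1) : SmoothDisk := ⟨diskAlphaOp q, diskAlphaOp_mem q⟩

/-- The class `r_+(β)` in `C^∞(D²_{q+})`: the operator `π_+(β)`, `ε_x ↦ q^x ε_x`. -/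
def diskBetaPlus (q : Set.Ioo (0 : ℝ) 1) : SmoothDisk := ⟨diskBetaOp q, diskBetaOp_mem q⟩

/-- The class `r_-(β)` in `C^∞(D²_{q-})`: the operator `π_-(β)`, `ε_x ↦ -q^x ε_x`. -/
def diskBetaMinus (q : Set.Ioo (0 : ℝ) 1) : SmoothDisk := -diskBetaPlus q

end SUq2

end

open SUq2

/-!
As `α_±` and `β_±` shift the label `n` by `±1`, they are eigenvectors of the derivation `δ`, and `ℬ`
is the `*`-algebra which they generate. Their matrix coefficients at the labels `n, x, y` converge
as `n → ∞` with `x, y` fixed, and the limits are the coefficients of the prescribed elements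
`ρ(α_±)`, `ρ(β_±)`, acting on `ℓ²(ℕ) ⊗ ℓ²(ℕ) ⊗ C^∞(S¹)`, where the powers of `u` record the
displacement of `n`. The pairs `(T, t)` such that `T` acts asymptotically as `t`, and `T*` as `t*`,
form a `*`-algebra containing the four prescribed pairs. In such a pair `t` is determined by `T`,
because the tensor product acts faithfully; so over `ℬ` these pairs form the graph of `ρ`.
-/

noncomputable section

namespace SUq2

section WeightedShift

variable {ι κ : Type} {e : ι ≃. κ} {w : ι → κ → ℂ} {T : Ell2 ι →L[ℂ] Ell2 κ}

theorem inner_ket (i : ι) (ξ : Ell2 ι) : inner ℂ (ket i) ξ = ξ i := by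
  classical
  rw [ket, lp.inner_single_left]
  simp

theorem single_eq_smul_ket [DecidableEq ι] (i : ι) (z : ℂ) :
    lp.single (E := fun _ : ι => ℂ) 2 i z = z • ket i := by
  ext j
  rw [lp.coeFn_smul, Pi.smul_apply, ket_apply]
  obtain rfl | hj := eq_or_ne j i
  · simp
  · simp [hj]

theorem ext_ket {V : Type*} [NormedAddCommGroup V] [NormedSpace ℂ V]
    {S T : Ell2 ι →L[ℂ] V} (h : ∀ i, S (ket i) = T (ket i)) : S = T := by
  classical
  ext1 ξ
  have hξ := lp.hasSum_single (p := 2) (by norm_num) ξ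
  simp only [single_eq_smul_ket] at hξ
  refine (hξ.mapL S).unique ?_
  simpa only [map_smul, h] using hξ.mapL T

/-- `T` is a weighted shift along the partial bijection `e`: it sends the basis vector of index `i`
to `w i j` times the basis vector of index `j = e i`, and to `0` where `e` is not defined. The
weight depends on both ends of the arrow `i ↦ j`, which makes the notion symmetric under
`T ↦ T*`. -/
structure IsWeightedShift (e : ι ≃. κ) (w : ι → κ → ℂ) (T : Ell2 ι →L[ℂ] Ell2 κ) : Prop where
  map_ket {i j} : j ∈ e i → T (ket i) = w i j • ket j
  map_ket_of_eq_none {i} : e i = none → T (ket i) = 0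

theorem isWeightedShift_weightedShift (e : ι ≃. κ) (c : ι → ℂ) (hc : ∀ i, ‖c i‖ ≤ 1) :
    IsWeightedShift e (fun i _ => c i) (weightedShift e c hc) where
  map_ket hj := by rw [weightedShift_ket, Option.mem_def.1 hj, Option.elim_some]
  map_ket_of_eq_none hi := by rw [weightedShift_ket, hi, Option.elim_none]

namespace IsWeightedShift

theorem const_smul (hT : IsWeightedShift e w T) (z : ℂ) :
    IsWeightedShift e (fun i j => z * w i j) (z • T) where
  map_ket hj := by rw [smul_apply, hT.map_ket hj, smul_smul]
  map_ket_of_eq_none hi := by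
    rw [smul_apply, hT.map_ket_of_eq_none hi, smul_zero]

theorem map_ket_apply_of_notMem (hT : IsWeightedShift e w T) {i : ι} {j : κ} (hj : j ∉ e i) :
    T (ket i) j = 0 := by
  classical
  cases hi : e i with
  | none => rw [hT.map_ket_of_eq_none hi, lp.coeFn_zero, Pi.zero_apply]
  | some k =>
    have hjk : j ≠ k := fun h => hj (by rw [hi, h, Option.mem_some])
    rw [hT.map_ket hi, lp.coeFn_smul, Pi.smul_apply, ket_apply, if_neg hjk, smul_zero]

theorem map_ket_apply (hT : IsWeightedShift e w T) {i : ι} {j : κ} (hj : j ∈ e i) :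
    T (ket i) j = w i j := by
  classical
  rw [hT.map_ket hj, lp.coeFn_smul, Pi.smul_apply, ket_apply, if_pos rfl, smul_eq_mul, mul_one]

end IsWeightedShift

theorem adjoint_ket_apply (T : Ell2 ι →L[ℂ] Ell2 κ) (i : ι) (j : κ) :
    T.adjoint (ket j) i = star (T (ket i) j) := by
  rw [← inner_ket i, ← inner_ket j, ContinuousLinearMap.adjoint_inner_right, RCLike.star_def,
    inner_conj_symm]

theorem IsWeightedShift.adjoint (hT : IsWeightedShift e w T) :
    IsWeightedShift e.symm (fun j i => star (w i j)) T.adjoint where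
  map_ket {j i} hi := by
    classical
    ext i'
    rw [adjoint_ket_apply, lp.coeFn_smul, Pi.smul_apply, ket_apply]
    obtain rfl | hne := eq_or_ne i' i
    · rw [hT.map_ket_apply (e.mem_iff_mem.1 hi), if_pos rfl, smul_eq_mul, mul_one]
    · rw [hT.map_ket_apply_of_notMem fun h => hne (e.inj h (e.mem_iff_mem.1 hi)), if_neg hne,
        star_zero, smul_zero]
  map_ket_of_eq_none {j} hj := by
    ext i
    rw [adjoint_ket_apply, hT.map_ket_apply_of_notMem fun h => ?_, star_zero, lp.coeFn_zero,
      Pi.zero_apply]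
    rw [← e.mem_iff_mem, hj] at h
    exact Option.not_mem_none _ h

end WeightedShift

section Derivation

theorem IsAbsD.inner_eq {ξ η ξ' η' : Hil} (h : IsAbsD ξ η) (h' : IsAbsD ξ' η') :
    inner ℂ ξ' η = inner ℂ η' ξ := by
  refine (lp.hasSum_inner ξ' η).unique ?_
  convert lp.hasSum_inner η' ξ using 2 with p
  rw [h p, h' p]
  simp only [RCLike.inner_apply, map_mul, Complex.conj_ofReal]
  ring

theorem isAbsD_ket (p : Idx) : IsAbsD (ket p) ((p.n : ℂ) • ket p) := by
  classical
  intro p'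
  rw [abs_diracEigenvalue, lp.coeFn_smul, Pi.smul_apply, ket_apply]
  obtain rfl | h := eq_or_ne p' p
  · simp
  · simp [h]

theorem IsDelta.unique {T S S' : Hil →L[ℂ] Hil} (h : IsDelta T S) (h' : IsDelta T S') :
    S = S' := by
  refine ext_ket fun p => ?_
  refine add_left_cancel (a := T ((p.n : ℂ) • ket p)) ?_
  ext p'
  rw [h _ _ (isAbsD_ket p) p', h' _ _ (isAbsD_ket p) p']

theorem IsDelta.mul {T S T' S' : Hil →L[ℂ] Hil} (h : IsDelta T S) (h' : IsDelta T' S') :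
    IsDelta (T * T') (S * T' + T * S') := by
  intro ξ η hξ
  have hcomp : (T * T') η + (S * T' + T * S') ξ = T (T' η + S' ξ) + S (T' ξ) := by
    simp only [mul_apply_eq_comp, add_apply, map_add]
    abel
  rw [hcomp]
  exact h _ _ (h' ξ η hξ)

theorem isDelta_algebraMap (c : ℂ) : IsDelta (algebraMap ℂ (Hil →L[ℂ] Hil) c) 0 := by
  intro ξ η hξ p
  simp only [Algebra.algebraMap_eq_smul_one, smul_apply, one_apply_eq_self,
    zero_apply, add_zero, lp.coeFn_smul, Pi.smul_apply, smul_eq_mul]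
  rw [hξ p, mul_left_comm]

theorem IsDelta.star {T S : Hil →L[ℂ] Hil} (h : IsDelta T S) : IsDelta (star T) (-star S) := by
  intro ξ η hξ p
  have hsymm := hξ.inner_eq (h _ _ (isAbsD_ket p))
  rw [← inner_ket p, ← inner_ket p]
  simp only [neg_apply, ContinuousLinearMap.star_eq_adjoint, inner_add_right, inner_neg_right,
    ContinuousLinearMap.adjoint_inner_right]
  rw [hsymm, map_smul, inner_add_left, inner_smul_left, abs_diracEigenvalue]
  simp

theorem exists_isDelta_of_mem_adjoin {s : Set (Hil →L[ℂ] Hil)}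
    (hs : ∀ T ∈ s, ∃ S ∈ StarAlgebra.adjoin ℂ s, IsDelta T S) {T : Hil →L[ℂ] Hil}
    (hT : T ∈ StarAlgebra.adjoin ℂ s) : ∃ S ∈ StarAlgebra.adjoin ℂ s, IsDelta T S := by
  induction hT using StarAlgebra.adjoin_induction with
  | mem T hT => exact hs T hT
  | algebraMap c => exact ⟨0, zero_mem _, isDelta_algebraMap c⟩
  | add T T' _ _ ih ih' =>
    obtain ⟨S, hS, hTS⟩ := ih
    obtain ⟨S', hS', hTS'⟩ := ih'
    exact ⟨S + S', add_mem hS hS', hTS.add hTS'⟩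
  | mul T T' hT hT' ih ih' =>
    obtain ⟨S, hS, hTS⟩ := ih
    obtain ⟨S', hS', hTS'⟩ := ih'
    exact ⟨S * T' + T * S', add_mem (mul_mem hS hT') (mul_mem hT hS'), hTS.mul hTS'⟩
  | star T _ ih =>
    obtain ⟨S, hS, hTS⟩ := ih
    exact ⟨-star S, neg_mem (star_mem hS), hTS.star⟩

theorem mem_adjoin_of_isDeltaPow {s : Set (Hil →L[ℂ] Hil)}
    (hs : ∀ T ∈ s, ∃ S ∈ StarAlgebra.adjoin ℂ s, IsDelta T S) {T : Hil →L[ℂ] Hil}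
    (hT : T ∈ StarAlgebra.adjoin ℂ s) {k : ℕ} {S : Hil →L[ℂ] Hil} (hTS : IsDeltaPow k T S) :
    S ∈ StarAlgebra.adjoin ℂ s := by
  induction k generalizing S with
  | zero => exact (show S = T from hTS) ▸ hT
  | succ k ih =>
    obtain ⟨R, hTR, hRS⟩ := hTS
    obtain ⟨S', hS', hRS'⟩ := exists_isDelta_of_mem_adjoin hs (ih hTR)
    exact hRS.unique hRS' ▸ hS'

end Derivation

section Generators

theorem mem_ofInjective {ι κ : Type} {g : ι → κ} (hg : Function.Injective g) {i : ι} {j : κ} :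
    j ∈ ofInjective g hg i ↔ g i = j :=
  Option.some_inj

/-- The partial bijection `e` moves the label `n` by `s`, the label `x` by `e₁` and the label `y`
by `e₂`. -/
def IsTranslation (e : Idx ≃. Idx) (s : ℤ) (e₁ e₂ : ℕ ≃. ℕ) : Prop :=
  ∀ p p', p' ∈ e p ↔ (p'.n : ℤ) = p.n + s ∧ p'.x ∈ e₁ p.x ∧ p'.y ∈ e₂ p.y

namespace IsTranslation

variable {e : Idx ≃. Idx} {s : ℤ} {e₁ e₂ : ℕ ≃. ℕ}

theorem symm (he : IsTranslation e s e₁ e₂) : IsTranslation e.symm (-s) e₁.symm e₂.symm := by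
  intro p p'
  rw [e.mem_iff_mem, he, e₁.mem_iff_mem, e₂.mem_iff_mem, ← sub_eq_add_neg, eq_sub_iff_add_eq,
    eq_comm]

theorem isDelta_weightedShift (he : IsTranslation e s e₁ e₂) {c : Idx → ℂ} (hc : ∀ p, ‖c p‖ ≤ 1) :
    IsDelta (weightedShift e c hc) ((s : ℂ) • weightedShift e c hc) := by
  refine SUq2.isDelta_weightedShift e c hc s fun p p' hp => ?_
  exact_mod_cast ((he p p').1 ((e.mem_iff_mem).1 hp)).1

end IsTranslation

theorem isTranslation_raise :
    IsTranslation (ofInjective raise raise_injective) 1 (PEquiv.refl ℕ) (PEquiv.refl ℕ) := by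
  intro p p'
  simp only [mem_ofInjective, Idx.ext_iff, raise, PEquiv.refl_apply, Option.mem_some_iff]
  omega

theorem isTranslation_raiseX :
    IsTranslation (ofInjective raiseX raiseX_injective) 1
      (ofInjective Nat.succ Nat.succ_injective) (PEquiv.refl ℕ) := by
  intro p p'
  simp only [mem_ofInjective, Idx.ext_iff, raiseX, PEquiv.refl_apply, Option.mem_some_iff]
  omega

theorem isTranslation_raiseY :
    IsTranslation (ofInjective raiseY raiseY_injective) 1 (PEquiv.refl ℕ)
      (ofInjective Nat.succ Nat.succ_injective) := by
  intro p p'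
  simp only [mem_ofInjective, Idx.ext_iff, raiseY, PEquiv.refl_apply, Option.mem_some_iff]
  omega

theorem isTranslation_raiseXY :
    IsTranslation (ofInjective raiseXY raiseXY_injective) 1
      (ofInjective Nat.succ Nat.succ_injective) (ofInjective Nat.succ Nat.succ_injective) := by
  intro p p'
  simp only [mem_ofInjective, Idx.ext_iff, raiseXY]
  omega

variable (q : Set.Ioo (0 : ℝ) 1)

/-- The components of `α` and `β` that raise or lower `n` by one; they generate `ℬ`. -/
def generators : Set (Hil →L[ℂ] Hil) :=
  {alphaPlus q, alphaMinus q, betaPlus q, betaMinus q}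

theorem exists_isDelta_smul_of_mem_generators {T : Hil →L[ℂ] Hil} (hT : T ∈ generators q) :
    ∃ s : ℤ, IsDelta T ((s : ℂ) • T) := by
  obtain rfl | rfl | rfl | rfl := hT
  · exact ⟨_, isTranslation_raise.isDelta_weightedShift _⟩
  · exact ⟨_, isTranslation_raiseXY.symm.isDelta_weightedShift _⟩
  · exact ⟨_, isTranslation_raiseX.isDelta_weightedShift _⟩
  · exact ⟨_, isTranslation_raiseY.symm.isDelta_weightedShift _⟩

theorem coordAlgebra_le_adjoin_generators :
    coordAlgebra q ≤ StarAlgebra.adjoin ℂ (generators q) := by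
  have hgen := StarAlgebra.subset_adjoin ℂ (generators q)
  refine StarAlgebra.adjoin_le ?_
  rintro T (rfl | rfl)
  · exact add_mem (hgen (by simp [generators])) (hgen (by simp [generators]))
  · exact add_mem (hgen (by simp [generators])) (hgen (by simp [generators]))

theorem pdoAlgebra_eq_adjoin_generators :
    pdoAlgebra q = StarAlgebra.adjoin ℂ (generators q) := by
  refine le_antisymm (StarAlgebra.adjoin_le ?_) (StarAlgebra.adjoin_le ?_)
  · rintro S ⟨T, hT, k, hTS⟩
    refine mem_adjoin_of_isDeltaPow (fun T hT => ?_) (coordAlgebra_le_adjoin_generators q hT) hTS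
    obtain ⟨s, hs⟩ := exists_isDelta_smul_of_mem_generators q hT
    exact ⟨_, SMulMemClass.smul_mem _ (StarAlgebra.subset_adjoin ℂ _ hT), hs⟩
  · rintro T (rfl | rfl | rfl | rfl)
    exacts [alphaPlus_mem q, alphaMinus_mem q, betaPlus_mem q, betaMinus_mem q]

end Generators

open Filter Topology

section StarAlgebra

variable {R A B : Type*} [CommSemiring R] [StarRing R]
  [Semiring A] [Algebra R A] [StarRing A] [StarModule R A]

/-- The largest `*`-subalgebra contained in a subalgebra. -/
def starCore (S : Subalgebra R A) : StarSubalgebra R A where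
  toSubalgebra := S ⊓ star S
  star_mem' := by
    rintro a ⟨ha, ha'⟩
    exact ⟨ha', Subalgebra.star_mem_star_iff S a |>.2 ha⟩

theorem mem_starCore {S : Subalgebra R A} {a : A} : a ∈ starCore S ↔ a ∈ S ∧ star a ∈ S :=
  Iff.rfl

variable [Semiring B] [Algebra R B] [StarRing B]

theorem starAlgHom_ext_of_eq_adjoin {S : StarSubalgebra R A} {s : Set A}
    (hS : S = StarAlgebra.adjoin R s) {ρ σ : S →⋆ₐ[R] B}
    (h : ∀ a (ha : a ∈ S), a ∈ s → ρ ⟨a, ha⟩ = σ ⟨a, ha⟩) : ρ = σ := by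
  subst hS
  exact StarAlgHom.ext_adjoin fun a ha => h a a.2 ha

end StarAlgebra

section Graph

variable {R A B : Type*} [CommRing R] [StarRing R] [Ring A] [Algebra R A] [StarRing A]
  [StarModule R A] [Ring B] [Algebra R B] [StarRing B] [StarModule R B]

theorem eq_of_mem_graph {G : StarSubalgebra R (A × B)} (hG : ∀ b, ((0 : A), b) ∈ G → b = 0)
    {a : A} {b b' : B} (h : (a, b) ∈ G) (h' : (a, b') ∈ G) : b = b' := by
  refine sub_eq_zero.1 (hG _ ?_)
  simpa using sub_mem h h'

theorem exists_starAlgHom_of_graph {G : StarSubalgebra R (A × B)}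
    (hG : ∀ b, ((0 : A), b) ∈ G → b = 0) {S : StarSubalgebra R A}
    (hS : ∀ a ∈ S, ∃ b, (a, b) ∈ G) :
    ∃ ρ : S →⋆ₐ[R] B, ∀ a : S, ((a : A), ρ a) ∈ G := by
  choose ρ hρ using fun a : S => hS a a.2
  have hρ_eq {a : S} {b : B} (h : ((a : A), b) ∈ G) : ρ a = b := eq_of_mem_graph hG (hρ a) h
  exact ⟨{
    toFun := ρ
    map_one' := hρ_eq (one_mem G)
    map_mul' := fun a b => hρ_eq (mul_mem (hρ a) (hρ b))
    map_zero' := hρ_eq (zero_mem G)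
    map_add' := fun a b => hρ_eq (add_mem (hρ a) (hρ b))
    commutes' := fun r => hρ_eq (algebraMap_mem G r)
    map_star' := fun a => hρ_eq (star_mem (hρ a)) }, hρ⟩

theorem exists_mem_graph_of_mem_adjoin {G : StarSubalgebra R (A × B)} {s : Set A}
    (hs : ∀ a ∈ s, ∃ b, (a, b) ∈ G) {a : A} (ha : a ∈ StarAlgebra.adjoin R s) :
    ∃ b, (a, b) ∈ G := by
  have hle : StarAlgebra.adjoin R s ≤ G.map (StarAlgHom.fst R A B) :=
    StarAlgebra.adjoin_le fun a ha => by
      obtain ⟨b, hb⟩ := hs a ha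
      exact ⟨(a, b), hb, rfl⟩
  obtain ⟨⟨_, b⟩, hb, rfl⟩ := hle ha
  exact ⟨b, hb⟩

end Graph

section Asymptotics

variable {𝕜 α ι H M A : Type*} [RCLike 𝕜] [NormedAddCommGroup H] [InnerProductSpace 𝕜 H]
  [AddCommGroup M] [Module 𝕜 M] [Ring A] [Algebra 𝕜 A]

variable (𝕜 H) in
/-- The space of families of vectors converging to zero along the filter `l`. -/
def nullFamilies (l : Filter α) : Submodule 𝕜 (α → H) where
  carrier := {ξ | Tendsto ξ l (𝓝 0)}
  add_mem' {ξ η} hξ hη := by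
    have h := Tendsto.add hξ hη
    rwa [add_zero] at h
  zero_mem' := tendsto_const_nhds
  smul_mem' c ξ hξ := by
    have h := Tendsto.const_smul hξ c
    rwa [smul_zero] at h

variable (𝕜) in
/-- The pairs `(ξ, v)` such that, up to a family converging to zero along `l`, the family `ξ` is a
linear combination of the families `e i`, and `v` is the combination of the vectors `f i` with the
same coefficients. -/
def asymptoticSpan (l : Filter α) (e : ι → α → H) (f : ι → M) : Submodule 𝕜 ((α → H) × M) :=
  Submodule.span 𝕜 (Set.range fun i => (e i, f i)) ⊔ (nullFamilies 𝕜 H l).prod ⊥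

variable {l : Filter α} {e : ι → α → H} {f : ι → M}

theorem mem_asymptoticSpan_iff {ξ : α → H} {v : M} :
    (ξ, v) ∈ asymptoticSpan 𝕜 l e f ↔ ∃ c : ι →₀ 𝕜,
      Tendsto (ξ - c.sum fun i z => z • e i) l (𝓝 0) ∧ v = c.sum fun i z => z • f i := by
  have hfst (c : ι →₀ 𝕜) : (c.sum fun i z => z • (e i, f i)).1 = c.sum fun i z => z • e i :=
    map_finsuppSum (LinearMap.fst 𝕜 (α → H) M) _ _
  have hsnd (c : ι →₀ 𝕜) : (c.sum fun i z => z • (e i, f i)).2 = c.sum fun i z => z • f i :=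
    map_finsuppSum (LinearMap.snd 𝕜 (α → H) M) _ _
  rw [asymptoticSpan, Submodule.mem_sup]
  constructor
  · rintro ⟨_, hs, ⟨ν, z⟩, ⟨hν, hz⟩, h⟩
    obtain ⟨c, rfl⟩ := Finsupp.mem_span_range_iff_exists_finsupp.1 hs
    obtain rfl : z = 0 := hz
    refine ⟨c, ?_, ?_⟩
    · rw [← hfst, show ξ = _ from congrArg Prod.fst h.symm, Prod.fst_add, add_sub_cancel_left]
      exact hν
    · rw [← hsnd, show v = _ from congrArg Prod.snd h.symm, Prod.snd_add, add_zero]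
  · rintro ⟨c, hξ, rfl⟩
    refine ⟨_, Finsupp.mem_span_range_iff_exists_finsupp.2 ⟨c, rfl⟩, (_, 0), ⟨hξ, rfl⟩, ?_⟩
    ext1
    · rw [Prod.fst_add, hfst, add_sub_cancel]
    · rw [Prod.snd_add, hsnd, add_zero]

theorem mem_asymptoticSpan_of_tendsto {ξ : α → H} {c : 𝕜} {i : ι}
    (h : Tendsto (ξ - c • e i) l (𝓝 0)) : (ξ, c • f i) ∈ asymptoticSpan 𝕜 l e f :=
  mem_asymptoticSpan_iff.2 ⟨Finsupp.single i c, by simpa using h, by simp⟩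

theorem mem_asymptoticSpan_of_tendsto_zero {ξ : α → H} (h : Tendsto ξ l (𝓝 0)) :
    (ξ, 0) ∈ asymptoticSpan 𝕜 l e f :=
  mem_asymptoticSpan_iff.2 ⟨0, by simpa using h, by simp⟩

theorem eq_zero_of_zero_mem_asymptoticSpan [l.NeBot]
    (he : ∀ i, ∀ᶠ a in l, ‖e i a‖ = 1)
    (he' : Pairwise fun i j => ∀ᶠ a in l, inner 𝕜 (e i a) (e j a) = 0) {v : M}
    (hv : (0, v) ∈ asymptoticSpan 𝕜 l e f) : v = 0 := by
  obtain ⟨c, hc, rfl⟩ := mem_asymptoticSpan_iff.1 hv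
  suffices c = 0 by rw [this, Finsupp.sum_zero_index]
  ext j
  rw [zero_sub] at hc
  have hlim : Tendsto (fun a => inner 𝕜 (e j a) ((c.sum fun i z => z • e i) a)) l (𝓝 0) := by
    refine squeeze_zero_norm' ?_ (tendsto_zero_iff_norm_tendsto_zero.1 hc)
    filter_upwards [he j] with a ha
    simpa [ha] using norm_inner_le_norm (𝕜 := 𝕜) (e j a) ((c.sum fun i z => z • e i) a)
  have hcoeff : ∀ᶠ a in l, inner 𝕜 (e j a) ((c.sum fun i z => z • e i) a) = c j := by
    have horth : ∀ᶠ a in l, ∀ i ∈ c.support, i ≠ j → inner 𝕜 (e j a) (e i a) = 0 :=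
      (Finset.eventually_all _).2 fun i _ => eventually_imp_distrib_left.2 fun hij => he' hij.symm
    filter_upwards [he j, horth] with a ha horth
    rw [Finsupp.sum, Finset.sum_apply, inner_sum, Finset.sum_eq_single j]
    · simp [inner_smul_right, inner_self_eq_norm_sq_to_K, ha]
    · intro i hi hij
      rw [Pi.smul_apply, inner_smul_right, horth i hi hij, mul_zero]
    · intro hj
      rw [Finsupp.notMem_support_iff.1 hj, zero_smul, Pi.zero_apply, inner_zero_right]
  exact tendsto_nhds_unique (tendsto_const_nhds.congr' (hcoeff.mono fun _ h => h.symm)) hlim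

variable (l e f) in
/-- The pairs `(T, t)` of operators which act in the same way on the families `e` and on the
vectors `f`, asymptotically along `l`. The algebra `A` acts on the vectors through `π`. -/
def asymptoticOperators (π : A →ₐ[𝕜] Module.End 𝕜 M) : Subalgebra 𝕜 ((H →L[𝕜] H) × A) where
  carrier := {P | ∀ ξ v, (ξ, v) ∈ asymptoticSpan 𝕜 l e f →
    (P.1 ∘ ξ, π P.2 v) ∈ asymptoticSpan 𝕜 l e f}
  mul_mem' {P Q} hP hQ ξ v h := by
    rw [Prod.snd_mul, map_mul]
    exact hP _ _ (hQ ξ v h)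
  add_mem' {P Q} hP hQ ξ v h := by
    rw [Prod.snd_add, map_add]
    exact add_mem (hP ξ v h) (hQ ξ v h)
  algebraMap_mem' c ξ v h := by
    rw [show (algebraMap 𝕜 ((H →L[𝕜] H) × A) c).2 = algebraMap 𝕜 A c from rfl, AlgHom.commutes]
    exact Submodule.smul_mem _ c h

variable {π : A →ₐ[𝕜] Module.End 𝕜 M}

theorem mem_asymptoticOperators {T : H →L[𝕜] H} {t : A}
    (h : ∀ i, (T ∘ e i, π t (f i)) ∈ asymptoticSpan 𝕜 l e f) :
    (T, t) ∈ asymptoticOperators l e f π := by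
  let Φ : ((α → H) × M) →ₗ[𝕜] (α → H) × M := (T.toLinearMap.compLeft α).prodMap (π t)
  have hΦ : asymptoticSpan 𝕜 l e f ≤ (asymptoticSpan 𝕜 l e f).comap Φ := by
    refine sup_le (Submodule.span_le.2 ?_) ?_
    · rintro _ ⟨i, rfl⟩
      exact h i
    · rintro ⟨ξ, v⟩ ⟨hξ, hv⟩
      obtain rfl : v = 0 := hv
      have hTξ : Tendsto (T ∘ ξ) l (𝓝 0) := by
        simpa only [map_zero] using (T.continuous.tendsto 0).comp hξ
      change (T ∘ ξ, π t 0) ∈ asymptoticSpan 𝕜 l e f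
      rw [map_zero]
      exact mem_asymptoticSpan_of_tendsto_zero hTξ
  exact fun ξ v hξv => hΦ hξv

theorem eq_zero_of_zero_mem_asymptoticOperators [l.NeBot]
    (he : ∀ i, ∀ᶠ a in l, ‖e i a‖ = 1)
    (he' : Pairwise fun i j => ∀ᶠ a in l, inner 𝕜 (e i a) (e j a) = 0) {t : A}
    (ht : (0, t) ∈ asymptoticOperators l e f π) (i : ι) : π t (f i) = 0 := by
  have hi : (e i, f i) ∈ asymptoticSpan 𝕜 l e f :=
    Submodule.mem_sup_left (Submodule.subset_span ⟨i, rfl⟩)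
  exact eq_zero_of_zero_mem_asymptoticSpan he he' (ht _ _ hi)

end Asymptotics

section JointlyInjective

variable {R V V' W W' ι κ : Type*} [CommRing R]
  [AddCommGroup V] [AddCommGroup V'] [AddCommGroup W] [AddCommGroup W']
  [Module R V] [Module R V'] [Module R W] [Module R W']

theorem eq_zero_of_forall_rTensor [Module.Free R W] {f : ι → V →ₗ[R] V'}
    (hf : ∀ v, (∀ i, f i v = 0) → v = 0) {t : V ⊗[R] W} (ht : ∀ i, (f i).rTensor W t = 0) :
    t = 0 := by
  classical
  let b := Module.Free.chooseBasis R W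
  have hcoord (i) (j) (s : V ⊗[R] W) :
      TensorProduct.equivFinsuppOfBasisRight b ((f i).rTensor W s) j =
        f i (TensorProduct.equivFinsuppOfBasisRight b s j) := by
    induction s with
    | zero => simp
    | add s s' hs hs' => simp [hs, hs']
    | tmul v w => simp
  refine (TensorProduct.equivFinsuppOfBasisRight b).map_eq_zero_iff.1 ?_
  ext j
  refine hf _ fun i => ?_
  rw [← hcoord, ht, map_zero, Finsupp.zero_apply]

theorem eq_zero_of_forall_lTensor [Module.Free R V] {g : κ → W →ₗ[R] W'}
    (hg : ∀ w, (∀ j, g j w = 0) → w = 0) {t : V ⊗[R] W} (ht : ∀ j, (g j).lTensor V t = 0) :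
    t = 0 := by
  refine (TensorProduct.comm R V W).map_eq_zero_iff.1 (eq_zero_of_forall_rTensor hg fun j => ?_)
  rw [LinearMap.rTensor, TensorProduct.map_comm, ← LinearMap.lTensor, ht, map_zero]

theorem eq_zero_of_forall_map [Module.Free R V'] [Module.Free R W] {f : ι → V →ₗ[R] V'}
    {g : κ → W →ₗ[R] W'} (hf : ∀ v, (∀ i, f i v = 0) → v = 0) (hg : ∀ w, (∀ j, g j w = 0) → w = 0)
    {t : V ⊗[R] W} (ht : ∀ i j, TensorProduct.map (f i) (g j) t = 0) : t = 0 := by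
  refine eq_zero_of_forall_rTensor hf fun i => eq_zero_of_forall_lTensor hg fun j => ?_
  rw [← LinearMap.comp_apply, LinearMap.lTensor_comp_rTensor, ht]

end JointlyInjective

section Target

/-- The algebra `C^∞(D²_{q+}) ⊗ C^∞(D²_{q-}) ⊗ C^∞(S¹)`. -/
abbrev TargetAlgebra : Type := SmoothDisk ⊗[ℂ] SmoothDisk ⊗[ℂ] SmoothCircle

/-- The space on which `TargetAlgebra` acts faithfully, through `targetRep`. -/
abbrev TargetModule : Type := (Ell2 ℕ ⊗[ℂ] Ell2 ℕ) ⊗[ℂ] SmoothCircle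

/-- The defining representation of the smooth Toeplitz algebra. -/
def diskRep : SmoothDisk →ₐ[ℂ] Module.End ℂ (Ell2 ℕ) where
  toFun a := ((a : Ell2 ℕ →L[ℂ] Ell2 ℕ) : Ell2 ℕ →ₗ[ℂ] Ell2 ℕ)
  map_one' := rfl
  map_mul' _ _ := rfl
  map_zero' := rfl
  map_add' _ _ := rfl
  commutes' _ := rfl

/-- The tensor product of two copies of `diskRep` with the action of `C^∞(S¹)` on itself by
multiplication. -/
def targetRep : TargetAlgebra →ₐ[ℂ] Module.End ℂ TargetModule :=
  (Module.endTensorEndAlgHom (R := ℂ) (S := ℂ) (A := ℂ)).comp (Algebra.TensorProduct.map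
    ((Module.endTensorEndAlgHom (R := ℂ) (S := ℂ) (A := ℂ)).comp
      (Algebra.TensorProduct.map diskRep diskRep)) (Algebra.lmul ℂ SmoothCircle))

theorem targetRep_tmul (a b : SmoothDisk) (f g : SmoothCircle) (ξ η : Ell2 ℕ) :
    targetRep (a ⊗ₜ b ⊗ₜ f) (ξ ⊗ₜ η ⊗ₜ g) =
      (a : Ell2 ℕ →L[ℂ] Ell2 ℕ) ξ ⊗ₜ (b : Ell2 ℕ →L[ℂ] Ell2 ℕ) η ⊗ₜ (f * g) := rfl

theorem eq_zero_of_targetRep_eq_zero {t : TargetAlgebra}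
    (ht : ∀ x y, targetRep t (ket x ⊗ₜ ket y ⊗ₜ 1) = 0) : t = 0 := by
  let ev (x : ℕ) : SmoothDisk →ₗ[ℂ] Ell2 ℕ := LinearMap.applyₗ (ket x) ∘ₗ diskRep.toLinearMap
  have hev (a : SmoothDisk) (ha : ∀ x, ev x a = 0) : a = 0 := Subtype.ext (ext_ket ha)
  have hrep (x y : ℕ) : (TensorProduct.map (ev x) (ev y)).rTensor SmoothCircle =
      LinearMap.applyₗ (ket x ⊗ₜ ket y ⊗ₜ 1) ∘ₗ targetRep.toLinearMap := by
    refine TensorProduct.ext_threefold fun a b f => ?_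
    change _ = targetRep (a ⊗ₜ b ⊗ₜ f) (ket x ⊗ₜ ket y ⊗ₜ 1)
    rw [targetRep_tmul, mul_one]
    rfl
  refine eq_zero_of_forall_rTensor (f := fun i : ℕ × ℕ => TensorProduct.map (ev i.1) (ev i.2))
    (fun s hs => eq_zero_of_forall_map hev hev fun x y => hs (x, y)) fun i => ?_
  rw [hrep]
  exact ht i.1 i.2

/-- The coordinate function `u`, which is invertible, so that its integral powers make sense. -/
def circleUnitary : unitary SmoothCircle :=
  ⟨circleU, Unitary.mem_iff_star_mul_self.2 (Subtype.ext (ContinuousMap.ext fun z => by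
    change (starRingEnd ℂ) (z : ℂ) * z = 1
    rw [mul_comm, Complex.mul_conj, Circle.normSq_coe, Complex.ofReal_one]))⟩

/-- The vector `ε_x ⊗ ε_y ⊗ u ^ r`, for `i = (x, y, r)`. -/
def targetKet (i : ℕ × ℕ × ℤ) : TargetModule :=
  ket i.1 ⊗ₜ ket i.2.1 ⊗ₜ ((circleUnitary ^ i.2.2 : unitary SmoothCircle) : SmoothCircle)

end Target

section Corner

namespace Idx

/-- The index `(m, x, y)`. If there is none because `m` is too small, `m` is replaced by
`max x y`. -/
def corner (x y : ℕ) (m : ℤ) : Idx :=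
  ⟨max m.toNat (max x y), x, y, by omega, by omega⟩

theorem corner_n_eventually_eq (x y : ℕ) : ∀ᶠ m : ℤ in atTop, ((corner x y m).n : ℤ) = m := by
  filter_upwards [eventually_ge_atTop (max x y : ℤ)] with m hm
  change ((max m.toNat (max x y) : ℕ) : ℤ) = m
  omega

theorem tendsto_corner_n (x y : ℕ) : Tendsto (fun m => (corner x y m).n) atTop atTop :=
  tendsto_natCast_atTop_iff (R := ℤ) |>.1 <|
    tendsto_id.congr' ((corner_n_eventually_eq x y).mono fun _ h => h.symm)

end Idx

/-- The basis vectors `e^{(n/2)}_{i,j}` with fixed labels `x`, `y` and `n = N + r` as a family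
indexed by `N`; asymptotically, it corresponds to the vector `targetKet (x, y, r)`. -/
def cornerKet (i : ℕ × ℕ × ℤ) (N : ℤ) : Hil :=
  ket (Idx.corner i.1 i.2.1 (N + i.2.2))

theorem norm_ket {ι : Type} (i : ι) : ‖(ket i : Ell2 ι)‖ = 1 := by
  classical
  rw [ket, lp.norm_single (by norm_num), norm_one]

theorem norm_cornerKet (i : ℕ × ℕ × ℤ) (N : ℤ) : ‖cornerKet i N‖ = 1 := norm_ket _

theorem inner_cornerKet_eventually_eq_zero :
    Pairwise fun i j => ∀ᶠ N in atTop, inner ℂ (cornerKet i N) (cornerKet j N) = 0 := by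
  classical
  rintro ⟨x, y, r⟩ ⟨x', y', r'⟩ hne
  filter_upwards [(tendsto_atTop_add_const_right _ r tendsto_id).eventually
      (Idx.corner_n_eventually_eq x y),
    (tendsto_atTop_add_const_right _ r' tendsto_id).eventually
      (Idx.corner_n_eventually_eq x' y')] with N hn hn'
  rw [cornerKet, cornerKet, inner_ket, ket_apply, if_neg]
  intro heq
  have hx : x = x' := congrArg Idx.x heq
  have hy : y = y' := congrArg Idx.y heq
  have hr : N + r = N + r' := hn.symm.trans ((congrArg (fun p => (p.n : ℤ)) heq).trans hn')
  exact hne (by rw [hx, hy, add_left_cancel hr])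

/-- The pairs of an operator `T` on the Hilbert space and an element `t` of the target algebra such
that `T` acts on `cornerKet` asymptotically as `t` acts on `targetKet`, and `T*` as `t*`. -/
def symbolAlgebra : StarSubalgebra ℂ ((Hil →L[ℂ] Hil) × TargetAlgebra) :=
  starCore (asymptoticOperators atTop cornerKet targetKet targetRep)

theorem eq_zero_of_zero_mem_symbolAlgebra (t : TargetAlgebra) (ht : (0, t) ∈ symbolAlgebra) :
    t = 0 :=
  eq_zero_of_targetRep_eq_zero fun x y => eq_zero_of_zero_mem_asymptoticOperators
    (fun i => Eventually.of_forall (norm_cornerKet i)) inner_cornerKet_eventually_eq_zero ht.1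
    (x, y, 0)

variable {e : Idx ≃. Idx} {w : Idx → Idx → ℂ} {T : Hil →L[ℂ] Hil} {s : ℤ}
  {e₁ e₂ : ℕ ≃. ℕ} {w₁ w₂ : ℕ → ℕ → ℂ} {a b : SmoothDisk}

theorem targetRep_targetKet (ha : IsWeightedShift e₁ w₁ a) (hb : IsWeightedShift e₂ w₂ b)
    {x y x' y' : ℕ} (hx : x' ∈ e₁ x) (hy : y' ∈ e₂ y) (r : ℤ) :
    targetRep (a ⊗ₜ b ⊗ₜ ((circleUnitary ^ s : unitary SmoothCircle) : SmoothCircle))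
      (targetKet (x, y, r)) = (w₁ x x' * w₂ y y') • targetKet (x', y', r + s) := by
  rw [targetKet, targetRep_tmul, ha.map_ket hx, hb.map_ket hy, targetKet,
    TensorProduct.smul_tmul_smul, ← TensorProduct.smul_tmul', ← Submonoid.coe_mul, ← zpow_add,
    add_comm s]

theorem IsTranslation.corner_mem (he : IsTranslation e s e₁ e₂) {x y x' y' : ℕ} (hx : x' ∈ e₁ x)
    (hy : y' ∈ e₂ y) :
    ∀ᶠ m in atTop, Idx.corner x' y' (m + s) ∈ e (Idx.corner x y m) := by
  filter_upwards [Idx.corner_n_eventually_eq x y,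
    (tendsto_atTop_add_const_right _ s tendsto_id).eventually
      (Idx.corner_n_eventually_eq x' y')] with m hm hm'
  exact (he _ _).2 ⟨hm'.trans (congrArg (· + s) hm.symm), hx, hy⟩

theorem tendsto_comp_cornerKet_sub_smul (he : IsTranslation e s e₁ e₂) (hT : IsWeightedShift e w T)
    {x y x' y' : ℕ} (hx : x' ∈ e₁ x) (hy : y' ∈ e₂ y) {z : ℂ}
    (hw : Tendsto (fun m => w (.corner x y m) (.corner x' y' (m + s))) atTop (𝓝 z)) (r : ℤ) :
    Tendsto (T ∘ cornerKet (x, y, r) - z • cornerKet (x', y', r + s)) atTop (𝓝 0) := by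
  have hshift : Tendsto (fun N : ℤ => N + r) atTop atTop :=
    tendsto_atTop_add_const_right _ r tendsto_id
  rw [tendsto_zero_iff_norm_tendsto_zero]
  refine (tendsto_iff_norm_sub_tendsto_zero.1 (hw.comp hshift)).congr' ?_
  filter_upwards [hshift.eventually (he.corner_mem hx hy)] with N hN
  have hket : T (cornerKet (x, y, r) N) = w (.corner x y (N + r)) (.corner x' y' (N + r + s)) •
      cornerKet (x', y', r + s) N := by
    rw [cornerKet, hT.map_ket hN, cornerKet, add_assoc]
  change _ = ‖T (cornerKet (x, y, r) N) - z • cornerKet (x', y', r + s) N‖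
  rw [hket, ← sub_smul, norm_smul, norm_cornerKet, mul_one, Function.comp_apply]

theorem map_cornerKet_eq_zero (he : IsTranslation e s e₁ e₂) (hT : IsWeightedShift e w T)
    {x y : ℕ} (hxy : e₁ x = none ∨ e₂ y = none) (r N : ℤ) : T (cornerKet (x, y, r) N) = 0 := by
  refine hT.map_ket_of_eq_none (Option.eq_none_iff_forall_not_mem.2 fun p hp => ?_)
  obtain ⟨-, hx, hy⟩ := (he _ _).1 hp
  obtain h | h := hxy
  · exact Option.eq_none_iff_forall_not_mem.1 h _ hx
  · exact Option.eq_none_iff_forall_not_mem.1 h _ hy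

theorem mem_asymptoticOperators_of_isWeightedShift (he : IsTranslation e s e₁ e₂)
    (hT : IsWeightedShift e w T) (ha : IsWeightedShift e₁ w₁ a) (hb : IsWeightedShift e₂ w₂ b)
    (hw : ∀ x y, ∀ x' ∈ e₁ x, ∀ y' ∈ e₂ y, Tendsto
      (fun m => w (.corner x y m) (.corner x' y' (m + s))) atTop (𝓝 (w₁ x x' * w₂ y y'))) :
    (T, a ⊗ₜ b ⊗ₜ ((circleUnitary ^ s : unitary SmoothCircle) : SmoothCircle)) ∈
      asymptoticOperators atTop cornerKet targetKet targetRep := by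
  refine mem_asymptoticOperators ?_
  rintro ⟨x, y, r⟩
  cases hx : e₁ x with
  | none =>
    rw [targetKet, targetRep_tmul, ha.map_ket_of_eq_none hx, TensorProduct.zero_tmul,
      TensorProduct.zero_tmul]
    refine mem_asymptoticSpan_of_tendsto_zero (tendsto_const_nhds.congr fun N => ?_)
    exact (map_cornerKet_eq_zero he hT (.inl hx) r N).symm
  | some x' =>
    cases hy : e₂ y with
    | none =>
      rw [targetKet, targetRep_tmul, hb.map_ket_of_eq_none hy, TensorProduct.tmul_zero,
        TensorProduct.zero_tmul]
      refine mem_asymptoticSpan_of_tendsto_zero (tendsto_const_nhds.congr fun N => ?_)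
      exact (map_cornerKet_eq_zero he hT (.inr hy) r N).symm
    | some y' =>
      rw [targetRep_targetKet ha hb hx hy]
      exact mem_asymptoticSpan_of_tendsto
        (tendsto_comp_cornerKet_sub_smul he hT hx hy (hw x y x' hx y' hy) r)

theorem mem_symbolAlgebra_of_isWeightedShift {u : SmoothCircle}
    (hu : ((circleUnitary ^ s : unitary SmoothCircle) : SmoothCircle) = u)
    (he : IsTranslation e s e₁ e₂) (hT : IsWeightedShift e w T)
    (ha : IsWeightedShift e₁ w₁ a) (hb : IsWeightedShift e₂ w₂ b)
    (hw : ∀ x y, ∀ x' ∈ e₁ x, ∀ y' ∈ e₂ y, Tendsto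
      (fun m => w (.corner x y m) (.corner x' y' (m + s))) atTop (𝓝 (w₁ x x' * w₂ y y'))) :
    (T, a ⊗ₜ[ℂ] b ⊗ₜ[ℂ] u) ∈ symbolAlgebra := by
  subst hu
  refine mem_starCore.2 ⟨mem_asymptoticOperators_of_isWeightedShift he hT ha hb hw, ?_⟩
  have hstar : star (T, a ⊗ₜ[ℂ] b ⊗ₜ[ℂ] ((circleUnitary ^ s : unitary SmoothCircle) : SmoothCircle))
      = (T.adjoint, star a ⊗ₜ[ℂ] star b ⊗ₜ[ℂ]
        ((circleUnitary ^ (-s) : unitary SmoothCircle) : SmoothCircle)) := by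
    rw [zpow_neg, ← Unitary.star_eq_inv, Unitary.coe_star]
    rfl
  rw [hstar]
  refine mem_asymptoticOperators_of_isWeightedShift he.symm hT.adjoint ha.adjoint hb.adjoint ?_
  intro x' y' x hx y hy
  have hlim := (hw x y x' (e₁.mem_iff_mem.1 hx) y' (e₂.mem_iff_mem.1 hy)).star.comp
    (tendsto_atTop_add_const_right _ (-s) tendsto_id)
  simpa only [star_mul', Function.comp_def, id, neg_add_cancel_right] using hlim

end Corner

section Coefficients

variable {q : ℝ} (hq : |q| < 1)
include hq

theorem tendsto_sqrt_one_sub_pow {f : ℕ → ℕ} (hf : Tendsto f atTop atTop) :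
    Tendsto (fun n => √(1 - q ^ f n)) atTop (𝓝 1) := by
  simpa using (((tendsto_pow_atTop_nhds_zero_of_abs_lt_one hq).comp hf).const_sub 1).sqrt

theorem tendsto_sqrt_one_sub_pow_mul_add (k : ℕ) :
    Tendsto (fun n => √(1 - q ^ (2 * n + k))) atTop (𝓝 1) :=
  tendsto_sqrt_one_sub_pow hq <|
    tendsto_atTop_mono (fun n => show n ≤ 2 * n + k by omega) tendsto_id

theorem tendsto_sqrt_one_sub_pow_mul_sub_add (x k : ℕ) :
    Tendsto (fun n => √(1 - q ^ (2 * (n - x) + k))) atTop (𝓝 1) :=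
  (tendsto_sqrt_one_sub_pow_mul_add hq k).comp (tendsto_sub_atTop_nat x)

theorem tendsto_aPlus (x y : ℕ) :
    Tendsto (fun n => aPlus q n x y) atTop (𝓝 (q ^ (x + y + 1))) := by
  have hnum := (tendsto_sqrt_one_sub_pow_mul_sub_add hq y 2).mul
    (tendsto_sqrt_one_sub_pow_mul_sub_add hq x 2)
  have hden := (tendsto_sqrt_one_sub_pow_mul_add hq 2).mul (tendsto_sqrt_one_sub_pow_mul_add hq 4)
  simpa [aPlus] using (hnum.div hden (by norm_num)).const_mul (q ^ (x + y + 1))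

theorem tendsto_aMinus (x y : ℕ) :
    Tendsto (fun n => aMinus q n x y) atTop (𝓝 (√(1 - q ^ (2 * x)) * √(1 - q ^ (2 * y)))) := by
  have hden := (tendsto_sqrt_one_sub_pow_mul_add hq 0).mul (tendsto_sqrt_one_sub_pow_mul_add hq 2)
  simpa [aMinus, div_eq_mul_inv, mul_comm √(1 - q ^ (2 * x))] using
    (hden.inv₀ (by norm_num)).const_mul (√(1 - q ^ (2 * y)) * √(1 - q ^ (2 * x)))

theorem tendsto_bPlus (x y : ℕ) :
    Tendsto (fun n => bPlus q n x y) atTop (𝓝 (-q ^ y * √(1 - q ^ (2 * x + 2)))) := by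
  have hnum := (tendsto_sqrt_one_sub_pow_mul_sub_add hq y 2).mul_const √(1 - q ^ (2 * x + 2))
  have hden := (tendsto_sqrt_one_sub_pow_mul_add hq 2).mul (tendsto_sqrt_one_sub_pow_mul_add hq 4)
  simpa [bPlus] using (hnum.div hden (by norm_num)).const_mul (-q ^ y)

theorem tendsto_bMinus (x y : ℕ) :
    Tendsto (fun n => bMinus q n x y) atTop (𝓝 (q ^ x * √(1 - q ^ (2 * y)))) := by
  have hnum := (tendsto_sqrt_one_sub_pow_mul_sub_add hq x 0).const_mul √(1 - q ^ (2 * y))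
  have hden := (tendsto_sqrt_one_sub_pow_mul_add hq 0).mul (tendsto_sqrt_one_sub_pow_mul_add hq 2)
  simpa [bMinus] using (hnum.div hden (by norm_num)).const_mul (q ^ x)

end Coefficients

section Symbols

theorem coe_circleUnitary_zpow_one :
    ((circleUnitary ^ (1 : ℤ) : unitary SmoothCircle) : SmoothCircle) = circleU := by
  rw [zpow_one]
  rfl

theorem coe_circleUnitary_zpow_neg_one :
    ((circleUnitary ^ (-1 : ℤ) : unitary SmoothCircle) : SmoothCircle) = star circleU := by
  rw [zpow_neg, zpow_one, ← Unitary.star_eq_inv, Unitary.coe_star]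
  rfl

theorem tendsto_ofReal_comp_corner_n {c : ℕ → ℝ} {L : ℝ} {z : ℂ} (hc : Tendsto c atTop (𝓝 L))
    (hz : (L : ℂ) = z) (x y : ℕ) :
    Tendsto (fun m => (c (Idx.corner x y m).n : ℂ)) atTop (𝓝 z) :=
  hz ▸ (Complex.continuous_ofReal.tendsto L).comp (hc.comp (Idx.tendsto_corner_n x y))

variable (q : Set.Ioo (0 : ℝ) 1)

theorem abs_coe_lt_one : |(q : ℝ)| < 1 :=
  abs_lt.2 ⟨neg_one_lt_zero.trans q.2.1, q.2.2⟩

theorem isWeightedShift_diskAlpha :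
    IsWeightedShift (ofInjective Nat.succ Nat.succ_injective).symm
      (fun x _ => (√(1 - (q : ℝ) ^ (2 * x)) : ℂ)) (diskAlpha q) :=
  isWeightedShift_weightedShift _ _ fun _ => norm_sqrt_le q _

theorem isWeightedShift_star_diskAlpha :
    IsWeightedShift (ofInjective Nat.succ Nat.succ_injective)
      (fun _ x => (√(1 - (q : ℝ) ^ (2 * x)) : ℂ)) (star (diskAlpha q)) := by
  simpa [ContinuousLinearMap.star_eq_adjoint] using (isWeightedShift_diskAlpha q).adjoint

theorem isWeightedShift_diskBetaPlus :
    IsWeightedShift (PEquiv.refl ℕ) (fun x _ => (((q : ℝ) ^ x : ℝ) : ℂ)) (diskBetaPlus q) :=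
  isWeightedShift_weightedShift _ _ fun x => by
    rw [Complex.norm_real]
    exact abs_pow_le_one q x

theorem isWeightedShift_star_diskBetaPlus :
    IsWeightedShift (PEquiv.refl ℕ) (fun _ x => (((q : ℝ) ^ x : ℝ) : ℂ))
      (star (diskBetaPlus q)) := by
  simpa [ContinuousLinearMap.star_eq_adjoint] using (isWeightedShift_diskBetaPlus q).adjoint

theorem isWeightedShift_diskBetaMinus :
    IsWeightedShift (PEquiv.refl ℕ) (fun x _ => -1 * (((q : ℝ) ^ x : ℝ) : ℂ))
      (diskBetaMinus q) := by
  simpa [diskBetaMinus] using (isWeightedShift_diskBetaPlus q).const_smul (-1)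

theorem alphaPlus_mem_symbolAlgebra :
    (alphaPlus q, (-(q : ℂ)) • (star (diskBetaPlus q) ⊗ₜ[ℂ] diskBetaMinus q ⊗ₜ[ℂ] circleU)) ∈
      symbolAlgebra := by
  change (alphaPlus q, ((-(q : ℂ)) • star (diskBetaPlus q)) ⊗ₜ[ℂ] diskBetaMinus q ⊗ₜ[ℂ] circleU) ∈
    symbolAlgebra
  have hβ : IsWeightedShift (PEquiv.refl ℕ) (fun _ x => -(q : ℂ) * (((q : ℝ) ^ x : ℝ) : ℂ))
      ((-(q : ℂ)) • star (diskBetaPlus q) : SmoothDisk) :=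
    (isWeightedShift_star_diskBetaPlus q).const_smul _
  refine mem_symbolAlgebra_of_isWeightedShift coe_circleUnitary_zpow_one isTranslation_raise
    (isWeightedShift_weightedShift _ _ (norm_aPlus_le q)) hβ (isWeightedShift_diskBetaMinus q) ?_
  rintro x y _ ⟨⟩ _ ⟨⟩
  refine tendsto_ofReal_comp_corner_n (tendsto_aPlus (abs_coe_lt_one q) x y) ?_ x y
  push_cast
  ring

theorem alphaMinus_mem_symbolAlgebra :
    (alphaMinus q, diskAlpha q ⊗ₜ[ℂ] diskAlpha q ⊗ₜ[ℂ] star circleU) ∈ symbolAlgebra := by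
  refine mem_symbolAlgebra_of_isWeightedShift coe_circleUnitary_zpow_neg_one
    isTranslation_raiseXY.symm (isWeightedShift_weightedShift _ _ (norm_aMinus_le q))
    (isWeightedShift_diskAlpha q) (isWeightedShift_diskAlpha q) fun x y _ _ _ _ =>
      tendsto_ofReal_comp_corner_n (tendsto_aMinus (abs_coe_lt_one q) x y)
        (Complex.ofReal_mul _ _) x y

theorem betaPlus_mem_symbolAlgebra :
    (betaPlus q, star (diskAlpha q) ⊗ₜ[ℂ] diskBetaMinus q ⊗ₜ[ℂ] circleU) ∈ symbolAlgebra := by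
  refine mem_symbolAlgebra_of_isWeightedShift coe_circleUnitary_zpow_one isTranslation_raiseX
    (isWeightedShift_weightedShift _ _ (norm_bPlus_le q)) (isWeightedShift_star_diskAlpha q)
    (isWeightedShift_diskBetaMinus q) ?_
  rintro x y _ ⟨⟩ _ ⟨⟩
  refine tendsto_ofReal_comp_corner_n (tendsto_bPlus (abs_coe_lt_one q) x y) ?_ x y
  rw [Nat.succ_eq_add_one, mul_add_one]
  push_cast
  ring

theorem betaMinus_mem_symbolAlgebra :
    (betaMinus q, diskBetaPlus q ⊗ₜ[ℂ] diskAlpha q ⊗ₜ[ℂ] star circleU) ∈ symbolAlgebra := by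
  refine mem_symbolAlgebra_of_isWeightedShift coe_circleUnitary_zpow_neg_one
    isTranslation_raiseY.symm (isWeightedShift_weightedShift _ _ (norm_bMinus_le q))
    (isWeightedShift_diskBetaPlus q) (isWeightedShift_diskAlpha q) fun x y _ _ _ _ =>
      tendsto_ofReal_comp_corner_n (tendsto_bMinus (abs_coe_lt_one q) x y)
        (Complex.ofReal_mul _ _) x y

theorem exists_mem_symbolAlgebra {T : Hil →L[ℂ] Hil} (hT : T ∈ pdoAlgebra q) :
    ∃ t, (T, t) ∈ symbolAlgebra := by
  rw [pdoAlgebra_eq_adjoin_generators] at hT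
  refine exists_mem_graph_of_mem_adjoin ?_ hT
  rintro _ (rfl | rfl | rfl | rfl)
  exacts [⟨_, alphaPlus_mem_symbolAlgebra q⟩, ⟨_, alphaMinus_mem_symbolAlgebra q⟩,
    ⟨_, betaPlus_mem_symbolAlgebra q⟩, ⟨_, betaMinus_mem_symbolAlgebra q⟩]

theorem exists_symbolHom :
    ∃ ρ : pdoAlgebra q →⋆ₐ[ℂ] TargetAlgebra, ∀ T : pdoAlgebra q, (T.1, ρ T) ∈ symbolAlgebra :=
  exists_starAlgHom_of_graph eq_zero_of_zero_mem_symbolAlgebra fun T hT =>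
    exists_mem_symbolAlgebra q (T := T) hT

/-- The symbol map `ρ`: its graph is the part of `symbolAlgebra` that lies over `pdoAlgebra q`. -/
def symbolHom : pdoAlgebra q →⋆ₐ[ℂ] TargetAlgebra :=
  (exists_symbolHom q).choose

theorem symbolHom_eq_of_mem_symbolAlgebra {T : Hil →L[ℂ] Hil} (hT : T ∈ pdoAlgebra q)
    {t : TargetAlgebra} (h : (T, t) ∈ symbolAlgebra) : symbolHom q ⟨T, hT⟩ = t :=
  eq_of_mem_graph eq_zero_of_zero_mem_symbolAlgebra ((exists_symbolHom q).choose_spec ⟨T, hT⟩) h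

end Symbols

end SUq2

end

theorem proposition4 (q : Set.Ioo (0 : ℝ) 1) :
    ∃! ρ : pdoAlgebra q →⋆ₐ[ℂ] SmoothDisk ⊗[ℂ] SmoothDisk ⊗[ℂ] SmoothCircle,
      ρ ⟨alphaPlus q, alphaPlus_mem q⟩ =
        (-(q : ℂ)) • (star (diskBetaPlus q) ⊗ₜ[ℂ] diskBetaMinus q ⊗ₜ[ℂ] circleU) ∧
      ρ ⟨alphaMinus q, alphaMinus_mem q⟩ =
        diskAlpha q ⊗ₜ[ℂ] diskAlpha q ⊗ₜ[ℂ] star circleU ∧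
      ρ ⟨betaPlus q, betaPlus_mem q⟩ =
        star (diskAlpha q) ⊗ₜ[ℂ] diskBetaMinus q ⊗ₜ[ℂ] circleU ∧
      ρ ⟨betaMinus q, betaMinus_mem q⟩ =
        diskBetaPlus q ⊗ₜ[ℂ] diskAlpha q ⊗ₜ[ℂ] star circleU := by
  have h_alphaPlus := symbolHom_eq_of_mem_symbolAlgebra q (alphaPlus_mem q)
    (alphaPlus_mem_symbolAlgebra q)
  have h_alphaMinus := symbolHom_eq_of_mem_symbolAlgebra q (alphaMinus_mem q)
    (alphaMinus_mem_symbolAlgebra q)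
  have h_betaPlus := symbolHom_eq_of_mem_symbolAlgebra q (betaPlus_mem q)
    (betaPlus_mem_symbolAlgebra q)
  have h_betaMinus := symbolHom_eq_of_mem_symbolAlgebra q (betaMinus_mem q)
    (betaMinus_mem_symbolAlgebra q)
  refine ⟨symbolHom q, ⟨h_alphaPlus, h_alphaMinus, h_betaPlus, h_betaMinus⟩, ?_⟩
  rintro ρ ⟨hρ_alphaPlus, hρ_alphaMinus, hρ_betaPlus, hρ_betaMinus⟩
  refine starAlgHom_ext_of_eq_adjoin (pdoAlgebra_eq_adjoin_generators q) ?_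
  rintro T - (rfl | rfl | rfl | rfl)
  exacts [hρ_alphaPlus.trans h_alphaPlus.symm, hρ_alphaMinus.trans h_alphaMinus.symm,
    hρ_betaPlus.trans h_betaPlus.symm, hρ_betaMinus.trans h_betaMinus.symm]
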